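/- Let $n\ge 1$, let $\mathbb F_n^+$ be the free monoid on $g_1,\dots,g_n$ with identity $g_0$ and word length $|\cdot|$, and for $X=(X_1,\dots,X_n)$ and a word $\alpha=g_{i_1}\cdots g_{i_k}$ put $X_\alpha=X_{i_1}\cdots X_{i_k}$, $X_{g_0}=I$. Let $f=\sum_{\alpha}a_\alpha X_\alpha$ be a positive regular free holomorphic function: $a_\alpha\ge 0$ for all $\alpha$, $a_{g_0}=0$, $a_{g_i}>0$ for all $i$, and $\limsup_{k\to\infty}\big(\sum_{|\alpha|=k}|a_\alpha|^2\big)^{1/2k}<\infty$. For a complex Hilbert space $\mathcal H$ let $\mathcal D_f(\mathcal H)$ be the set of $n$-tuples $(X_1,\dots,X_n)$ of bounded operators on $\mathcal H$ for which $\sum_{|\alpha|\ge1}a_\alpha X_\alpha X_\alpha^*$ converges in the weak operator topology to an operator of norm at most $1$, and let $\mathcal D_f(\mathbb C)=\{\lambda\in\mathbb C^n:\sum_{|\alpha|\ge1}a_\alpha|\lambda_\alpha|^2\le1\}$. Let $\mathcal D_{f,1/3}(\mathcal H)$ be the set of tuples $X$ with $(3X_1,\dots,3X_n)\in\mathcal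 D_f(\mathcal H)$, and define $\mathcal D_{f,1/3}(\mathbb C)$ in the same way. Put $b_{g_0}=1$ and, for $|\alpha|\ge1$, $b_\alpha=\sum_{j=1}^{|\alpha|}\sum a_{\gamma_1}\cdots a_{\gamma_j}$, where the inner sum is over all factorizations $\gamma_1\cdots\gamma_j=\alpha$ with every $|\gamma_i|\ge1$; then $b_\alpha>0$. On the full Fock space $F^2(H_n)$ with orthonormal basis $(e_\alpha)_{\alpha\in\mathbb F_n^+}$, let $W_1,\dots,W_n$ be the weighted left creation operators, $W_ie_\alpha=\sqrt{b_\alpha/b_{g_i\alpha}}\;e_{g_i\alpha}$. The Hardy algebra $F_n^\infty(\mathcal D_f)$ consists of the bounded operators $\varphi=\varphi(W_1,\dots,W_n)$ on $F^2(H_n)$ for which there are $c_\beta\in\mathbb C$ with $\sum_\beta|c_\beta|^2/b_\beta<\infty$ and $\varphi p=\sum_\beta c_\beta W_\beta p$ for every finite linear combination $p$ of the $e_\alpha$; one then writes $\varphi=\sum_\beta c_\beta W_\beta$. **Theorem (Bohr inequality for $F_n^\infty(\mathcal D_f)$).** Let $\varphi=\sum_\beta c_\beta W_\beta\in F_n^\infty(\mathcal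 D_f)$. 1. For every complex Hilbert space $\mathcal H$ and every $(T_1,\dots,T_n)\in\mathcal D_{f,1/3}(\mathcal H)$, the series $\sum_{\beta\in\mathbb F_n^+}|c_\beta|T_\beta$ converges unconditionally in the operator norm, $\sum_{k\ge0}\big\|\sum_{|\beta|=k}|c_\beta|T_\beta\big\|<\infty$, and $$\Big\|\sum_{\beta\in\mathbb F_n^+}|c_\beta|T_\beta\Big\|\le\|\varphi\|.$$ 2. For every $\lambda=(\lambda_1,\dots,\lambda_n)\in\mathcal D_{f,1/3}(\mathbb C)$, $$\sum_{\beta\in\mathbb F_n^+}|c_\beta||\lambda_\beta|\le\|\varphi\|.$$ 3. If $\varphi$ is not a scalar multiple of the identity, then the inequalities in 1 and 2 are strict. -/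

import Mathlib

open scoped InnerProductSpace

noncomputable section

namespace FreeDomain

/-- Words in `n` letters: the free monoid on `n` generators, with `[]` the identity, `++` the
product and `List.length` the length. The words of length `k` are the lists `List.ofFn w` with
`w : Fin k → Fin n`. -/
abbrev Word (n : ℕ) := List (Fin n)

/-- The product `X_{i₁} ⋯ X_{i_k}` along the word `g_{i₁} ⋯ g_{i_k}`; it is `1` at the empty word. -/
def wordProd {n : ℕ} {M : Type*} [Monoid M] (X : Fin n → M) (α : Word n) : M :=
  (α.map X).prod

/-- A positive regular free holomorphic function `f = ∑_α a_α X_α`, given by its coefficients. -/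
structure PosRegular (n : ℕ) where
  a : Word n → ℝ
  nonneg : ∀ α, 0 ≤ a α
  a_nil : a [] = 0
  a_letter_pos : ∀ i, 0 < a [i]
  limsup_lt_top :
    Filter.limsup (fun k : ℕ =>
      ENNReal.ofReal ((∑ w : Fin k → Fin n, |a (List.ofFn w)| ^ 2) ^ (1 / (2 * (k : ℝ)))))
      Filter.atTop < ⊤

/-- `∑ a_{γ₁} ⋯ a_{γ_j}` over all factorizations `γ₁ ⋯ γ_j = α` of the word `α` into `j` nonempty
words; the first factor runs over the nonempty prefixes of `α`. -/
def factorSum {n : ℕ} (a : Word n → ℝ) : ℕ → Word n → ℝ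
  | 0, α => if α = [] then 1 else 0
  | j + 1, α =>
    ∑ m ∈ Finset.range α.length, a (α.take (m + 1)) * factorSum a j (α.drop (m + 1))

namespace PosRegular

variable {n : ℕ} (f : PosRegular n)

/-- `b_α = ∑_{j ≤ |α|} ∑_{γ₁ ⋯ γ_j = α} a_{γ₁} ⋯ a_{γ_j}` (all `γ_i` nonempty). The term `j = 0`
is `1` for the empty word and `0` for all others. -/
def b (α : Word n) : ℝ := ∑ j ∈ Finset.range (α.length + 1), factorSum f.a j α

theorem factorSum_nonneg (j : ℕ) (α : Word n) : 0 ≤ factorSum f.a j α := by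
  induction j generalizing α with
  | zero => unfold factorSum; split_ifs <;> norm_num
  | succ j ih => exact Finset.sum_nonneg fun m _ => mul_nonneg (f.nonneg _) (ih _)

theorem b_nil : f.b [] = 1 := by simp [b, factorSum]

theorem mul_b_le (i : Fin n) (α : Word n) : f.a [i] * f.b α ≤ f.b (i :: α) := by
  unfold b
  rw [Finset.sum_range_succ' _ (i :: α).length, Finset.mul_sum, List.length_cons]
  refine le_add_of_le_of_nonneg (Finset.sum_le_sum fun j _ => ?_) (f.factorSum_nonneg 0 _)
  have h := Finset.single_le_sum (s := Finset.range (i :: α).length)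
    (f := fun m => f.a ((i :: α).take (m + 1)) * factorSum f.a j ((i :: α).drop (m + 1)))
    (fun m _ => mul_nonneg (f.nonneg _) (f.factorSum_nonneg _ _))
    (Finset.mem_range.2 (show 0 < (i :: α).length by simp))
  simpa [factorSum] using h

theorem b_pos (α : Word n) : 0 < f.b α := by
  induction α with
  | nil => simp [b_nil]
  | cons i α ih => exact (mul_pos (f.a_letter_pos i) ih).trans_le (f.mul_b_le i α)

end PosRegular

/-- The full Fock space on an `n`-dimensional Hilbert space, written in the orthonormal basis
`e_α = e_{i₁} ⊗ ⋯ ⊗ e_{i_k}` indexed by the words `α = g_{i₁} ⋯ g_{i_k}`. -/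
abbrev Fock (n : ℕ) := lp (fun _ : Word n => ℂ) 2

/-- The basis vector `e_α` of the Fock space; `e_[]` is the vacuum vector `1`. -/
def basisVec {n : ℕ} (α : Word n) : Fock n := lp.single 2 α (1 : ℂ)

/-- The polynomials in the Fock space: finite linear combinations of the `e_α`. -/
def polys (n : ℕ) : Submodule ℂ (Fock n) := Submodule.span ℂ (Set.range basisVec)

namespace PosRegular

variable {n : ℕ} (f : PosRegular n)

/-- The weight `√b_α / √b_{g_i α}`. -/
def weight (i : Fin n) (α : Word n) : ℝ := √(f.b α) / √(f.b (i :: α))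

/-- The sequence of coefficients of `W_i x`: the coefficient at `g_i α` is
`(√b_α / √b_{g_i α}) x_α`, and it is `0` at the words which do not begin with `g_i`. -/
def shiftFun (i : Fin n) (x : Word n → ℂ) : Word n → ℂ
  | [] => 0
  | j :: α => if j = i then (f.weight i α : ℂ) * x α else 0

theorem shiftFun_add (i : Fin n) (x y : Word n → ℂ) :
    f.shiftFun i (x + y) = f.shiftFun i x + f.shiftFun i y := by
  funext α
  rw [Pi.add_apply]
  cases α with
  | nil => simp [shiftFun]
  | cons j α => by_cases h : j = i <;> simp [shiftFun, h, mul_add]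

theorem shiftFun_smul (i : Fin n) (z : ℂ) (x : Word n → ℂ) :
    f.shiftFun i (z • x) = z • f.shiftFun i x := by
  funext α
  rw [Pi.smul_apply]
  cases α with
  | nil => simp [shiftFun]
  | cons j α => by_cases h : j = i <;> simp [shiftFun, h, mul_left_comm]

theorem weight_sq_le (i : Fin n) (α : Word n) : f.weight i α ^ 2 ≤ (f.a [i])⁻¹ := by
  unfold weight
  rw [div_pow, Real.sq_sqrt (f.b_pos _).le, Real.sq_sqrt (f.b_pos _).le,
    div_le_iff₀ (f.b_pos _), inv_mul_eq_div, le_div_iff₀ (f.a_letter_pos i), mul_comm]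
  exact f.mul_b_le i α

theorem sum_shiftFun_le (i : Fin n) (x : Fock n) (s : Finset (Word n)) :
    ∑ α ∈ s, ‖f.shiftFun i x α‖ ^ (2 : ENNReal).toReal
      ≤ (√(f.a [i])⁻¹ * ‖x‖) ^ (2 : ENNReal).toReal := by
  have h2 : (2 : ENNReal).toReal = ((2 : ℕ) : ℝ) := by norm_num
  have hinj : Function.Injective (fun α : Word n => i :: α) := fun α β h => by simpa using h
  have hstep : ∑ α ∈ s, ‖f.shiftFun i x α‖ ^ 2 ≤
      ∑ β ∈ s.preimage (fun α : Word n => i :: α) hinj.injOn, (f.a [i])⁻¹ * ‖x β‖ ^ 2 := by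
    rw [← Finset.sum_preimage (fun α : Word n => i :: α) s hinj.injOn
      (fun α => ‖f.shiftFun i x α‖ ^ 2)]
    · refine Finset.sum_le_sum fun β _ => ?_
      simp only [shiftFun, if_true, norm_mul, mul_pow, Complex.norm_real, Real.norm_eq_abs, sq_abs]
      exact mul_le_mul_of_nonneg_right (f.weight_sq_le i β) (sq_nonneg _)
    · intro α _ hα
      cases α with
      | nil => simp [shiftFun]
      | cons j α =>
        have : j ≠ i := fun h => hα ⟨α, by rw [h]⟩
        simp [shiftFun, this]
  have hx := lp.sum_rpow_le_norm_rpow (p := 2) (by norm_num) x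
    (s.preimage (fun α : Word n => i :: α) hinj.injOn)
  simp only [h2, Real.rpow_natCast] at hx ⊢
  rw [mul_pow, Real.sq_sqrt (inv_nonneg.2 (f.nonneg _))]
  rw [← Finset.mul_sum] at hstep
  exact hstep.trans (mul_le_mul_of_nonneg_left hx (inv_nonneg.2 (f.nonneg _)))

/-- The weighted left creation operator `W_i` on the Fock space, the bounded operator with
`W_i e_α = (√b_α / √b_{g_i α}) e_{g_i α}`. -/
def W (i : Fin n) : Fock n →L[ℂ] Fock n :=
  LinearMap.mkContinuous
    { toFun := fun x => ⟨f.shiftFun i x, memℓp_gen' (f.sum_shiftFun_le i x)⟩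
      map_add' := fun x y => Subtype.ext (f.shiftFun_add i x y)
      map_smul' := fun z x => Subtype.ext (f.shiftFun_smul i z x) }
    (√(f.a [i])⁻¹)
    (fun x => lp.norm_le_of_forall_sum_le (by norm_num) (by positivity) (f.sum_shiftFun_le i x))

theorem W_basisVec (i : Fin n) (α : Word n) :
    f.W i (basisVec α) = (f.weight i α : ℂ) • basisVec (i :: α) := by
  ext γ
  change f.shiftFun i (basisVec α) γ = (f.weight i α : ℂ) * (basisVec (i :: α) : Fock n) γ
  cases γ with
  | nil => simp [shiftFun, basisVec]
  | cons j γ =>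
    by_cases h : j = i
    · subst h
      by_cases h' : γ = α
      · subst h'; simp [shiftFun, basisVec]
      · simp [shiftFun, basisVec, h']
    · simp [shiftFun, basisVec, h]

/-- `φ` is the element `φ(W_1, …, W_n) = ∑_β c_β W_β` of the Hardy algebra `F_n^∞(D_f)`:
`∑_β |c_β|² / b_β < ∞`, and `φ` is a bounded operator on the Fock space with
`φ p = ∑_β c_β W_β p` for all polynomials `p`. Such a bounded `φ` exists exactly if
`p ↦ ∑_β c_β W_β p` is bounded on the unit ball of the polynomials, and it is then unique. -/
structure IsHardySeries (c : Word n → ℂ) (φ : Fock n →L[ℂ] Fock n) : Prop where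
  summable_sq : Summable fun β => ‖c β‖ ^ 2 * (1 / f.b β)
  hasSum_apply : ∀ p ∈ polys n, HasSum (fun β => c β • wordProd f.W β p) (φ p)

/-- The noncommutative domain `D_f(H)`: the tuples `X` for which `∑_{|α| ≥ 1} a_α X_α X_α^*`
converges in the weak operator topology to an operator of norm at most `1`. (The empty word does
not contribute, since its coefficient is `0`.) -/
def domain (H : Type*) [NormedAddCommGroup H] [InnerProductSpace ℂ H] [CompleteSpace H] :
    Set (Fin n → H →L[ℂ] H) :=
  {X | ∃ S : H →L[ℂ] H, ‖S‖ ≤ 1 ∧ ∀ x y : H,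
    HasSum (fun α => (f.a α : ℂ) *
      ⟪x, (wordProd X α * ContinuousLinearMap.adjoint (wordProd X α)) y⟫_ℂ) ⟪x, S y⟫_ℂ}

/-- `D_{f,r}(H)`: the tuples `X` with `(1/r) X ∈ D_f(H)`. -/
def scaledDomain (r : ℝ) (H : Type*) [NormedAddCommGroup H] [InnerProductSpace ℂ H]
    [CompleteSpace H] : Set (Fin n → H →L[ℂ] H) :=
  {X | (fun i => ((1 / r : ℝ) : ℂ) • X i) ∈ f.domain H}

/-- The scalar domain `D_f(ℂ) = {μ ∈ ℂⁿ : ∑_{|α| ≥ 1} a_α |μ_α|² ≤ 1}`. -/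
def scalarDomain : Set (Fin n → ℂ) :=
  {μ | (Summable fun α => f.a α * ‖wordProd μ α‖ ^ 2) ∧ ∑' α, f.a α * ‖wordProd μ α‖ ^ 2 ≤ 1}

/-- `D_{f,r}(ℂ)`: the points `μ` with `(1/r) μ ∈ D_f(ℂ)`. -/
def scaledScalarDomain (r : ℝ) : Set (Fin n → ℂ) :=
  {μ | (fun i => ((1 / r : ℝ) : ℂ) * μ i) ∈ f.scalarDomain}

end PosRegular

end FreeDomain

end

open scoped InnerProductSpace

noncomputable section

namespace FreeDomain

/-! Write `M = ‖φ‖`, `r = |c_[]|`, and let `V_k` (`homNorm`) be the weighted `ℓ²` norm of the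
coefficients of degree `k`. Two estimates carry the proof. On `D_f(H)` one has `∑_{|β|=k} b_β X_β
X_β^* ≤ 1` (`sum_b_mul_norm_sq_le`), because `b` satisfies a renewal equation with kernel `a`. With
`X = 3T`, Cauchy–Schwarz bounds the degree-`k` part by `V_k 3^{-k}` (`norm_sum_smul_wordProd_le`).
Only moduli of coefficients enter, so replacing `c_β` by `|c_β|` costs nothing. Compressing `φ` to
the vacuum and the words of length `k` gives a lower triangular block matrix with `c_[]` on the
diagonal; its norm is at most `M`, which forces `V_k M ≤ M² - r²` (`homNorm_mul_le`). Since `∑_{k≥1}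
3^{-k} = 1/2`, for `M > 0` the total is at most `r + (M² - r²)/(2M) = M - (M - r)²/(2M)`. Equality
could only occur for `r = M`, and then every `V_k` with `k ≥ 1` vanishes and `φ` is scalar. -/

/-! ### Words and products along words. -/

/-- The finite set of words of length `k`. -/
def words (n k : ℕ) : Finset (Word n) :=
  (Finset.univ : Finset (Fin k → Fin n)).map ⟨List.ofFn, List.ofFn_injective⟩

@[simp] theorem mem_words {n k : ℕ} {β : Word n} : β ∈ words n k ↔ β.length = k := by
  simp only [words, Finset.mem_map, Finset.mem_univ, true_and, Function.Embedding.coeFn_mk]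
  constructor
  · rintro ⟨w, rfl⟩
    simp
  · rintro rfl
    exact ⟨β.get, List.ofFn_get β⟩

theorem sum_words {n k : ℕ} {E : Type*} [AddCommMonoid E] (F : Word n → E) :
    ∑ β ∈ words n k, F β = ∑ w : Fin k → Fin n, F (List.ofFn w) := by
  simp [words]

theorem words_zero (n : ℕ) : words n 0 = {[]} := by
  ext β
  simp

theorem sum_words_take_drop {n k m : ℕ} (hm : m ≤ k) {E : Type*} [AddCommMonoid E]
    (F : Word n → Word n → E) :
    ∑ β ∈ words n k, F (β.take m) (β.drop m) =
      ∑ γ ∈ words n m, ∑ δ ∈ words n (k - m), F γ δ := by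
  rw [← Finset.sum_product']
  refine Finset.sum_nbij' (fun β => (β.take m, β.drop m)) (fun p => p.1 ++ p.2) ?_ ?_ ?_ ?_ ?_
  · intro β hβ
    have := mem_words.1 hβ
    simp only [Finset.mem_product, mem_words, List.length_take, List.length_drop]
    omega
  · rintro ⟨γ, δ⟩ h
    simp only [Finset.mem_product, mem_words] at h
    simp only [mem_words, List.length_append]
    omega
  · intro β _
    simp
  · rintro ⟨γ, δ⟩ h
    simp only [Finset.mem_product, mem_words] at h
    simp [← h.1]
  · intro β _
    rfl

section WordProd

variable {n : ℕ}

@[simp] theorem wordProd_nil {M : Type*} [Monoid M] (X : Fin n → M) : wordProd X [] = 1 := rfl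

@[simp] theorem wordProd_cons {M : Type*} [Monoid M] (X : Fin n → M) (i : Fin n) (α : Word n) :
    wordProd X (i :: α) = X i * wordProd X α := by
  simp [wordProd]

theorem wordProd_append {M : Type*} [Monoid M] (X : Fin n → M) (α β : Word n) :
    wordProd X (α ++ β) = wordProd X α * wordProd X β := by
  simp [wordProd]

theorem wordProd_smul {R A : Type*} [CommSemiring R] [Semiring A] [Algebra R A] (z : R)
    (X : Fin n → A) (α : Word n) :
    wordProd (fun i => z • X i) α = z ^ α.length • wordProd X α := by
  induction α with
  | nil => simp
  | cons i α ih => simp [ih, smul_smul, pow_succ]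

theorem map_wordProd {M N F : Type*} [Monoid M] [Monoid N] [FunLike F M N] [MonoidHomClass F M N]
    (g : F) (X : Fin n → M) (α : Word n) : g (wordProd X α) = wordProd (fun i => g (X i)) α := by
  induction α with
  | nil => simp
  | cons i α ih => simp [ih]

end WordProd

/-! ### Unconditional summability from bounds on fibres. -/

/-- A family whose finite sums over the fibres of `ℓ` are bounded by a summable sequence is
unconditionally summable. -/
theorem summable_and_norm_tsum_le_of_fiber_bound {ι κ E : Type*} [NormedAddCommGroup E]
    [CompleteSpace E] [DecidableEq ι] [DecidableEq κ]
    (ℓ : ι → κ) (fib : κ → Finset ι) (hfib : ∀ i, i ∈ fib (ℓ i)) (v : ι → E) {g : κ → ℝ}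
    (hg : Summable g)
    (h : ∀ k, ∀ s : Finset ι, (∀ i ∈ s, ℓ i = k) → ‖∑ i ∈ s, v i‖ ≤ g k) :
    Summable v ∧ ‖∑' i, v i‖ ≤ ∑' k, g k := by
  have hg0 : ∀ k, 0 ≤ g k := fun k => by simpa using h k ∅ (by simp)
  have key : ∀ s : Finset ι, ‖∑ i ∈ s, v i‖ ≤ ∑ k ∈ s.image ℓ, g k := by
    intro s
    rw [← Finset.sum_fiberwise_of_maps_to (t := s.image ℓ) (g := ℓ)
      (fun i hi => Finset.mem_image_of_mem _ hi)]
    exact (norm_sum_le _ _).trans (Finset.sum_le_sum fun k _ => h k _ (by simp))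
  have hs : Summable v := by
    rw [summable_iff_vanishing_norm]
    intro ε hε
    obtain ⟨K, hK⟩ := summable_iff_vanishing_norm.1 hg ε hε
    -- A finite set that avoids the whole fibres over `K` has its image under `ℓ` outside `K`.
    refine ⟨K.biUnion fib, fun t ht => (key t).trans_lt ((le_abs_self _).trans_lt (hK _ ?_))⟩
    rw [Finset.disjoint_left]
    intro k hk hkK
    obtain ⟨i, hi, rfl⟩ := Finset.mem_image.1 hk
    exact Finset.disjoint_left.1 ht hi (Finset.mem_biUnion.2 ⟨_, hkK, hfib i⟩)
  refine ⟨hs, le_of_tendsto hs.hasSum.norm (Filter.Eventually.of_forall fun s => ?_)⟩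
  exact (key s).trans (hg.sum_le_tsum _ fun k _ => hg0 k)

namespace PosRegular

variable {n : ℕ} (f : PosRegular n)

/-! ### The renewal equation for `b`. -/

theorem factorSum_eq_zero {a : Word n → ℝ} {j : ℕ} {α : Word n} (h : α.length < j) :
    factorSum a j α = 0 := by
  induction j generalizing α with
  | zero => omega
  | succ j ih =>
    refine Finset.sum_eq_zero fun m hm => ?_
    rw [ih, mul_zero]
    rw [List.length_drop]
    have := Finset.mem_range.1 hm
    omega

theorem sum_factorSum {N : ℕ} {α : Word n} (h : α.length < N) :
    ∑ j ∈ Finset.range N, factorSum f.a j α = f.b α := by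
  refine (Finset.sum_subset (Finset.range_subset_range.2 h) fun j _ hj => ?_).symm
  exact factorSum_eq_zero (by simpa using hj)

/-- Split off the first factor of each factorization. The remaining sum over `j` runs further than
the length of the remaining word requires, but the surplus terms vanish (`sum_factorSum`). -/
theorem b_eq_sum {α : Word n} (hα : α ≠ []) :
    f.b α = ∑ m ∈ Finset.range α.length, f.a (α.take (m + 1)) * f.b (α.drop (m + 1)) := by
  rw [b, Finset.sum_range_succ']
  simp only [factorSum, hα, if_false, add_zero]
  rw [Finset.sum_comm]
  refine Finset.sum_congr rfl fun m hm => ?_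
  have := Finset.mem_range.1 hm
  rw [← Finset.mul_sum, f.sum_factorSum]
  rw [List.length_drop]
  omega

/-! ### Estimates for homogeneous polynomials on the domain. -/

section Hilbert

variable {H : Type*} [NormedAddCommGroup H] [InnerProductSpace ℂ H] [CompleteSpace H]

open ContinuousLinearMap (adjoint)

/-- On the diagonal `x = y` the weakly convergent series has nonnegative terms, so partial sums stay
below `⟪x, S x⟫`. -/
theorem sum_a_mul_norm_sq_le {X : Fin n → H →L[ℂ] H} (hX : X ∈ f.domain H) (x : H)
    (s : Finset (Word n)) : ∑ α ∈ s, f.a α * ‖adjoint (wordProd X α) x‖ ^ 2 ≤ ‖x‖ ^ 2 := by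
  obtain ⟨S, hS, h⟩ := hX
  have hsum : HasSum (fun α => f.a α * ‖adjoint (wordProd X α) x‖ ^ 2) (⟪x, S x⟫_ℂ).re := by
    convert Complex.hasSum_re (h x x) using 2 with α
    rw [mul_apply_eq_comp, ← ContinuousLinearMap.adjoint_inner_left,
      inner_self_eq_norm_sq_to_K, Complex.re_ofReal_mul]
    norm_cast
  refine (sum_le_hasSum s (fun α _ => mul_nonneg (f.nonneg α) (sq_nonneg _)) hsum).trans ?_
  calc (⟪x, S x⟫_ℂ).re ≤ ‖⟪x, S x⟫_ℂ‖ := Complex.re_le_norm _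
    _ ≤ ‖x‖ * ‖S x‖ := norm_inner_le_norm _ _
    _ ≤ ‖x‖ * (1 * ‖x‖) := by gcongr; exact S.le_of_opNorm_le hS x
    _ = ‖x‖ ^ 2 := by ring

/-- `∑_{|β| = k} b_β X_β X_β^* ≤ 1` on the domain `D_f(H)`. -/
theorem sum_b_mul_norm_sq_le {X : Fin n → H →L[ℂ] H} (hX : X ∈ f.domain H) (k : ℕ) (x : H) :
    ∑ β ∈ words n k, f.b β * ‖adjoint (wordProd X β) x‖ ^ 2 ≤ ‖x‖ ^ 2 := by
  induction k using Nat.strong_induction_on generalizing x with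
  | _ k ih =>
    rcases Nat.eq_zero_or_pos k with rfl | hk
    · have h1 : adjoint (1 : H →L[ℂ] H) = 1 := star_one (H →L[ℂ] H)
      simp [words_zero, b_nil, h1]
    let F (γ δ : Word n) : ℝ :=
      f.a γ * (f.b δ * ‖adjoint (wordProd X δ) (adjoint (wordProd X γ) x)‖ ^ 2)
    have hβ : ∀ β ∈ words n k, f.b β * ‖adjoint (wordProd X β) x‖ ^ 2 =
        ∑ m ∈ Finset.range k, F (β.take (m + 1)) (β.drop (m + 1)) := by
      intro β hβ
      rw [mem_words] at hβ
      have hne : β ≠ [] := by rintro rfl; simp at hβ; omega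
      rw [f.b_eq_sum hne, hβ, Finset.sum_mul]
      refine Finset.sum_congr rfl fun m _ => ?_
      have : adjoint (wordProd X β) x = adjoint (wordProd X (β.drop (m + 1)))
          (adjoint (wordProd X (β.take (m + 1))) x) := by
        conv_lhs => rw [← List.take_append_drop (m + 1) β, wordProd_append]
        rw [ContinuousLinearMap.mul_def, ContinuousLinearMap.adjoint_comp,
          ContinuousLinearMap.comp_apply]
      rw [this, mul_assoc]
    rw [Finset.sum_congr rfl hβ, Finset.sum_comm]
    -- For a prefix `γ` of length `m + 1`, the induction hypothesis at `X_γ^* x` absorbs the sum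
    -- over suffixes. The remaining `γ`, of lengths `1` to `k`, form one finite partial sum of the
    -- series defining the domain.
    have hle : ∀ m ∈ Finset.range k,
        ∑ β ∈ words n k, F (β.take (m + 1)) (β.drop (m + 1)) ≤
          ∑ γ ∈ words n (m + 1), f.a γ * ‖adjoint (wordProd X γ) x‖ ^ 2 := by
      intro m hm
      have hm' := Finset.mem_range.1 hm
      rw [sum_words_take_drop hm' F]
      refine Finset.sum_le_sum fun γ _ => ?_
      rw [← Finset.mul_sum]
      exact mul_le_mul_of_nonneg_left (ih _ (by omega) _) (f.nonneg γ)
    refine (Finset.sum_le_sum hle).trans ?_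
    rw [← Finset.sum_biUnion]
    · exact f.sum_a_mul_norm_sq_le hX x _
    · intro i _ j _ hij
      refine Finset.disjoint_left.2 fun γ hi hj => hij ?_
      rw [mem_words] at hi hj
      omega

theorem sum_b_mul_norm_sq_le_of_mem_scaledDomain {r : ℝ} (hr : 0 < r) {T : Fin n → H →L[ℂ] H}
    (hT : T ∈ f.scaledDomain r H) (k : ℕ) (x : H) :
    ∑ β ∈ words n k, f.b β * ‖adjoint (wordProd T β) x‖ ^ 2 ≤ (r ^ k * ‖x‖) ^ 2 := by
  have hX : (fun i => ((1 / r : ℝ) : ℂ) • T i) ∈ f.domain H := hT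
  have h := f.sum_b_mul_norm_sq_le hX k x
  have hβ : ∀ β ∈ words n k,
      f.b β * ‖adjoint (wordProd (fun i => ((1 / r : ℝ) : ℂ) • T i) β) x‖ ^ 2 =
        ((1 / r) ^ k) ^ 2 * (f.b β * ‖adjoint (wordProd T β) x‖ ^ 2) := by
    intro β hβ
    rw [mem_words] at hβ
    have hadj : adjoint ((((1 / r : ℝ) : ℂ) ^ k) • wordProd T β) =
        (starRingEnd ℂ) (((1 / r : ℝ) : ℂ) ^ k) • adjoint (wordProd T β) :=
      LinearIsometryEquiv.map_smulₛₗ adjoint _ _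
    rw [wordProd_smul, hβ, hadj, smul_apply, norm_smul]
    simp only [RCLike.norm_conj, norm_pow, Complex.norm_real, Real.norm_eq_abs,
      abs_of_pos (one_div_pos.2 hr)]
    ring
  rw [Finset.sum_congr rfl hβ, ← Finset.mul_sum] at h
  rw [mul_pow]
  calc _ = (r ^ k) ^ 2 * (((1 / r) ^ k) ^ 2 *
        ∑ β ∈ words n k, f.b β * ‖adjoint (wordProd T β) x‖ ^ 2) := by
        rw [← mul_assoc, ← mul_pow, ← mul_pow, mul_one_div_cancel hr.ne']; simp
    _ ≤ _ := by gcongr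

/-- Cauchy–Schwarz for homogeneous polynomials on the scaled domain. -/
theorem norm_sum_smul_wordProd_le {r : ℝ} (hr : 0 < r) {T : Fin n → H →L[ℂ] H}
    (hT : T ∈ f.scaledDomain r H) (d : Word n → ℂ) {k : ℕ} {s : Finset (Word n)}
    (hs : s ⊆ words n k) {V : ℝ} (hV : 0 ≤ V)
    (hd : ∑ β ∈ words n k, ‖d β‖ ^ 2 / f.b β ≤ V ^ 2) :
    ‖∑ β ∈ s, d β • wordProd T β‖ ≤ V * r ^ k := by
  refine ContinuousLinearMap.opNorm_le_of_re_inner_le (by positivity) fun y x hy hx => ?_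
  have hterm : ∀ β ∈ s, ‖⟪(d β • wordProd T β) y, x⟫_ℂ‖ ≤
      (‖d β‖ / √(f.b β)) * (√(f.b β) * ‖adjoint (wordProd T β) x‖) := by
    intro β _
    have hb : √(f.b β) ≠ 0 := (Real.sqrt_pos.2 (f.b_pos β)).ne'
    rw [← mul_assoc, div_mul_cancel₀ _ hb, smul_apply, inner_smul_left,
      norm_mul, RCLike.norm_conj, ← ContinuousLinearMap.adjoint_inner_right]
    gcongr
    simpa [hy] using norm_inner_le_norm (𝕜 := ℂ) y (adjoint (wordProd T β) x)
  have hcs := Finset.sum_mul_sq_le_sq_mul_sq s (fun β => ‖d β‖ / √(f.b β))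
    (fun β => √(f.b β) * ‖adjoint (wordProd T β) x‖)
  have h1 : ∑ β ∈ s, (‖d β‖ / √(f.b β)) ^ 2 ≤ V ^ 2 := by
    refine le_trans ?_ hd
    simp only [div_pow, Real.sq_sqrt (f.b_pos _).le]
    exact Finset.sum_le_sum_of_subset_of_nonneg hs fun β _ _ =>
      div_nonneg (sq_nonneg _) (f.b_pos β).le
  have h2 : ∑ β ∈ s, (√(f.b β) * ‖adjoint (wordProd T β) x‖) ^ 2 ≤ (r ^ k) ^ 2 := by
    have h := f.sum_b_mul_norm_sq_le_of_mem_scaledDomain hr hT k x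
    rw [hx, mul_one] at h
    refine le_trans ?_ h
    simp only [mul_pow, Real.sq_sqrt (f.b_pos _).le]
    exact Finset.sum_le_sum_of_subset_of_nonneg hs fun β _ _ =>
      mul_nonneg (f.b_pos β).le (sq_nonneg _)
  have h3 := hcs.trans (mul_le_mul h1 h2 (Finset.sum_nonneg fun _ _ => sq_nonneg _) (sq_nonneg V))
  rw [← mul_pow] at h3
  rw [sum_apply, sum_inner]
  exact (RCLike.re_le_norm _).trans ((norm_sum_le _ _).trans ((Finset.sum_le_sum hterm).trans
    (abs_le_of_sq_le_sq' h3 (by positivity)).2))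

end Hilbert

/-! ### Matrix entries of Hardy algebra elements. -/

theorem wordProd_W_basisVec (β γ : Word n) :
    wordProd f.W β (basisVec γ) =
      ((√(f.b γ) / √(f.b (β ++ γ)) : ℝ) : ℂ) • basisVec (β ++ γ) := by
  have hb (α : Word n) : √(f.b α) ≠ 0 := (Real.sqrt_pos.2 (f.b_pos α)).ne'
  induction β with
  | nil => simp [div_self (hb γ)]
  | cons i β ih =>
    rw [wordProd_cons, mul_apply_eq_comp, ih, map_smul, W_basisVec, smul_smul,
      ← Complex.ofReal_mul, weight, div_mul_div_cancel₀ (hb _)]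
    rfl

end PosRegular

section HardySeries

variable {n : ℕ} {f : PosRegular n} {c : Word n → ℂ} {φ : Fock n →L[ℂ] Fock n}

theorem basisVec_apply (β γ : Word n) : (basisVec β : Fock n) γ = if γ = β then 1 else 0 := by
  rw [basisVec, lp.single_apply, Pi.single_apply]

theorem hasSum_apply_basisVec (hφ : f.IsHardySeries c φ) (γ δ : Word n) :
    HasSum (fun β => if γ = β ++ δ then c β * ((√(f.b δ) / √(f.b γ) : ℝ) : ℂ) else 0)
      (φ (basisVec δ) γ) := by
  have h := hφ.hasSum_apply (basisVec δ) (Submodule.subset_span ⟨δ, rfl⟩)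
  have h' := h.mapL (lp.evalCLM ℂ (fun _ : Word n => ℂ) 2 γ)
  have hterm : (fun β => if γ = β ++ δ then c β * ((√(f.b δ) / √(f.b γ) : ℝ) : ℂ) else 0) =
      fun β => lp.evalCLM ℂ (fun _ : Word n => ℂ) 2 γ (c β • wordProd f.W β (basisVec δ)) := by
    funext β
    rw [map_smul, f.wordProd_W_basisVec, map_smul]
    change _ = c β • _ • (basisVec (β ++ δ) : Fock n) γ
    rw [basisVec_apply]
    split_ifs with hγ
    · simp [hγ]
    · simp
  rw [hterm]
  exact h'

theorem apply_basisVec_nil (hφ : f.IsHardySeries c φ) (γ : Word n) :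
    φ (basisVec []) γ = c γ * ((1 / √(f.b γ) : ℝ) : ℂ) := by
  refine (hasSum_apply_basisVec hφ γ []).unique ?_
  convert hasSum_ite_eq γ (c γ * ((1 / √(f.b γ) : ℝ) : ℂ)) using 2 with β
  rcases eq_or_ne β γ with rfl | h
  · simp [PosRegular.b_nil]
  · simp [h, h.symm]

/-- `W_β` lengthens words by `|β|`, so only the empty `β` can contribute. This makes the compression
in `compression_le` triangular. -/
theorem apply_basisVec_of_length_le (hφ : f.IsHardySeries c φ) {γ δ : Word n}
    (h : γ.length ≤ δ.length) : φ (basisVec δ) γ = if γ = δ then c [] else 0 := by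
  refine (hasSum_apply_basisVec hφ γ δ).unique ?_
  have hnil : ∀ β : Word n, γ = β ++ δ → β = [] := by
    rintro β rfl
    simpa using h
  convert hasSum_ite_eq ([] : Word n) (if γ = δ then c [] else 0) using 2 with β
  by_cases hβ : β = []
  · subst hβ
    have hb : √(f.b δ) ≠ 0 := (Real.sqrt_pos.2 (f.b_pos δ)).ne'
    by_cases hγ : γ = δ <;> simp [hγ, hb]
  · simp [hβ, mt (hnil β) hβ]

/-! ### Coefficient estimates by compression. -/

/-- The weighted `ℓ²` norm of the homogeneous part of degree `k` of `∑_β c_β W_β`. -/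
def homNorm (f : PosRegular n) (c : Word n → ℂ) (k : ℕ) : ℝ :=
  √(∑ β ∈ words n k, ‖c β‖ ^ 2 / f.b β)

theorem homNorm_sq (f : PosRegular n) (c : Word n → ℂ) (k : ℕ) :
    homNorm f c k ^ 2 = ∑ β ∈ words n k, ‖c β‖ ^ 2 / f.b β :=
  Real.sq_sqrt (Finset.sum_nonneg fun β _ => div_nonneg (sq_nonneg _) (f.b_pos β).le)

theorem norm_sq_eq_homNorm_sq (f : PosRegular n) (c : Word n → ℂ) (k : ℕ) :
    ∑ β ∈ words n k, ‖c β * ((1 / √(f.b β) : ℝ) : ℂ)‖ ^ 2 = homNorm f c k ^ 2 := by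
  rw [homNorm_sq]
  refine Finset.sum_congr rfl fun β _ => ?_
  rw [norm_mul, mul_pow, Complex.norm_real, Real.norm_eq_abs, sq_abs, div_pow,
    Real.sq_sqrt (f.b_pos β).le]
  ring

theorem sum_norm_sq_le (x : Fock n) (s : Finset (Word n)) : ∑ α ∈ s, ‖x α‖ ^ 2 ≤ ‖x‖ ^ 2 := by
  simpa using lp.sum_rpow_le_norm_rpow (p := 2) (by norm_num) x s

theorem norm_sq_sum_smul_basisVec (s : Finset (Word n)) (g : Word n → ℂ) :
    ‖∑ α ∈ s, g α • (basisVec α : Fock n)‖ ^ 2 = ∑ α ∈ s, ‖g α‖ ^ 2 := by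
  have h := lp.norm_sum_single (p := 2) (E := fun _ : Word n => ℂ) (by norm_num) g s
  have h' : ∀ α, g α • (basisVec α : Fock n) = lp.single 2 α (g α) := fun α => by
    rw [basisVec, ← lp.single_smul, smul_eq_mul, mul_one]
  simpa [h'] using h

/-- The compression of `∑_β c_β W_β` to the span of the vacuum and the words of length `k`,
tested on `1 + u ∑_{|β| = k} c_β b_β^{-1/2} e_β`. -/
theorem compression_le (hφ : f.IsHardySeries c φ) {k : ℕ} (hk : k ≠ 0) (u : ℂ) :
    ‖c []‖ ^ 2 + ‖1 + u * c []‖ ^ 2 * homNorm f c k ^ 2 ≤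
      ‖φ‖ ^ 2 * (1 + ‖u‖ ^ 2 * homNorm f c k ^ 2) := by
  set v : Word n → ℂ := fun β => c β * ((1 / √(f.b β) : ℝ) : ℂ) with hv
  have hnil : ([] : Word n) ∉ words n k := by simpa using hk.symm
  set g : Word n → ℂ := fun β => if β = [] then 1 else u * v β with hg
  have hgw : ∀ β ∈ words n k, g β = u * v β := fun β hβ => by
    simp [hg, show β ≠ [] by rintro rfl; exact hnil hβ]
  set x : Fock n := ∑ α ∈ insert [] (words n k), g α • basisVec α with hx
  have hnx : ‖x‖ ^ 2 = 1 + ‖u‖ ^ 2 * homNorm f c k ^ 2 := by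
    rw [hx, norm_sq_sum_smul_basisVec, Finset.sum_insert hnil, ← norm_sq_eq_homNorm_sq,
      Finset.mul_sum]
    congr 1
    · simp [hg]
    · exact Finset.sum_congr rfl fun β hβ => by rw [hgw β hβ, norm_mul, mul_pow]
  have hcoord : ∀ γ : Word n, γ.length ≤ k → φ x γ =
      v γ + ∑ β ∈ words n k, if γ = β then u * v β * c [] else 0 := by
    intro γ hγ
    rw [hx, Finset.sum_insert hnil, map_add, map_smul, map_sum, lp.coeFn_add, Pi.add_apply,
      lp.coeFn_smul, Pi.smul_apply, apply_basisVec_nil hφ, lp.coeFn_sum, Finset.sum_apply]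
    congr 1
    · simp [hg, hv]
    · refine Finset.sum_congr rfl fun β hβ => ?_
      rw [map_smul, lp.coeFn_smul, Pi.smul_apply, hgw β hβ,
        apply_basisVec_of_length_le hφ (hγ.trans (mem_words.1 hβ).ge)]
      split_ifs <;> simp
  have h0 : φ x [] = c [] := by
    rw [hcoord [] (by simp), Finset.sum_ite_eq, if_neg hnil]
    simp [hv, f.b_nil]
  have h1 : ∀ γ ∈ words n k, φ x γ = (1 + u * c []) * v γ := by
    intro γ hγ
    rw [hcoord γ (mem_words.1 hγ).le, Finset.sum_ite_eq, if_pos hγ]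
    ring
  have hle := sum_norm_sq_le (φ x) (insert [] (words n k))
  rw [Finset.sum_insert hnil, h0, Finset.sum_congr rfl fun γ hγ => by
    rw [h1 γ hγ, norm_mul, mul_pow], ← Finset.mul_sum, norm_sq_eq_homNorm_sq] at hle
  refine hle.trans ?_
  rw [← hnx, ← mul_pow]
  gcongr
  exact φ.le_opNorm x

theorem norm_coeff_nil_le (hφ : f.IsHardySeries c φ) : ‖c []‖ ≤ ‖φ‖ := by
  have h1 := lp.norm_apply_le_norm (p := 2) (by norm_num) (φ (basisVec [])) []
  rw [apply_basisVec_nil hφ] at h1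
  have h2 := φ.le_opNorm (basisVec [])
  rw [basisVec, lp.norm_single (by norm_num)] at h2
  simpa [f.b_nil] using h1.trans h2

/-- The Cauchy-type estimate for the homogeneous parts of an element of the Hardy algebra. -/
theorem homNorm_mul_le (hφ : f.IsHardySeries c φ) {k : ℕ} (hk : k ≠ 0) :
    homNorm f c k * ‖φ‖ ≤ ‖φ‖ ^ 2 - ‖c []‖ ^ 2 := by
  set V := homNorm f c k
  set M := ‖φ‖
  set r := ‖c []‖
  have hV : 0 ≤ V := Real.sqrt_nonneg _
  have hM : 0 ≤ M := norm_nonneg _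
  have hr : 0 ≤ r := norm_nonneg _
  have hrM : r ≤ M := norm_coeff_nil_le hφ
  have key : ∀ t : ℝ, r ^ 2 + (1 + t * r ^ 2) ^ 2 * V ^ 2 ≤ M ^ 2 * (1 + (t * r) ^ 2 * V ^ 2) := by
    intro t
    -- The phase of `u` is chosen to make `u c_[] = t r²` real.
    have h := compression_le hφ hk ((t : ℂ) * (starRingEnd ℂ) (c []))
    have h1 : 1 + (t : ℂ) * (starRingEnd ℂ) (c []) * c [] = ((1 + t * r ^ 2 : ℝ) : ℂ) := by
      rw [mul_assoc, Complex.conj_mul']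
      push_cast
      rfl
    rw [h1, norm_mul, RCLike.norm_conj, Complex.norm_real, Complex.norm_real, Real.norm_eq_abs,
      Real.norm_eq_abs, sq_abs, mul_pow |t|, sq_abs, ← mul_pow t] at h
    exact h
  have hD : 0 ≤ M ^ 2 - r ^ 2 := by nlinarith
  refine (abs_le_of_sq_le_sq' ?_ hD).2
  rcases hV.eq_or_lt with hV0 | hV0
  · rw [← hV0]
    nlinarith
  -- For `r = 0` the quadratic in `t` is constant and its discriminant says nothing; `t = 0` already
  -- gives `V² ≤ M²`.
  rcases hr.eq_or_lt with hr0 | hr0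
  · have := key 0
    rw [← hr0] at this ⊢
    nlinarith [sq_nonneg M]
  -- `key` says that this quadratic in `t` is nonnegative. Its discriminant is `4 r² V² ((V M)² -
  -- (M² - r²)²)`.
  have hdisc := discrim_le_zero (a := r ^ 2 * V ^ 2 * (M ^ 2 - r ^ 2)) (b := -(2 * V ^ 2 * r ^ 2))
    (c := M ^ 2 - r ^ 2 - V ^ 2) fun t => by linarith [key t]
  rw [discrim] at hdisc
  have hpos : 0 < r ^ 2 * V ^ 2 := by positivity
  have : r ^ 2 * V ^ 2 * ((V * M) ^ 2 - (M ^ 2 - r ^ 2) ^ 2) ≤ 0 := by linarith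
  nlinarith [nonpos_of_mul_nonpos_right this hpos]

theorem homNorm_nonneg (f : PosRegular n) (c : Word n → ℂ) (k : ℕ) : 0 ≤ homNorm f c k :=
  Real.sqrt_nonneg _

theorem eq_smul_one_of_coeff_eq_zero (hφ : f.IsHardySeries c φ) (h : ∀ β, β ≠ [] → c β = 0) :
    φ = c [] • (1 : Fock n →L[ℂ] Fock n) := by
  have hb : ∀ δ : Word n, φ (basisVec δ) = c [] • basisVec δ := by
    intro δ
    refine (hφ.hasSum_apply (basisVec δ) (Submodule.subset_span ⟨δ, rfl⟩)).unique ?_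
    have := hasSum_single (f := fun β => c β • wordProd f.W β (basisVec δ)) [] fun β hβ => by
      rw [h β hβ, zero_smul]
    simpa using this
  ext1 x
  have hx := lp.hasSum_single (p := 2) (by norm_num) x
  refine (hx.mapL φ).unique ?_
  change HasSum _ (c [] • x)
  convert hx.const_smul (c []) using 2 with α
  have : lp.single 2 α (x α) = x α • (basisVec α : Fock n) := by
    rw [basisVec, ← lp.single_smul, smul_eq_mul, mul_one]
  rw [this, map_smul, hb, smul_comm]

/-- If `|c_[]| = ‖φ‖`, then `homNorm_mul_le` kills every coefficient of positive degree. -/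
theorem norm_coeff_nil_lt (hφ : f.IsHardySeries c φ)
    (h : ¬ ∃ z : ℂ, φ = z • (1 : Fock n →L[ℂ] Fock n)) : ‖c []‖ < ‖φ‖ := by
  refine lt_of_le_of_ne (norm_coeff_nil_le hφ) fun heq => h ⟨c [],
    eq_smul_one_of_coeff_eq_zero hφ fun β hβ => ?_⟩
  have hM : 0 < ‖φ‖ := norm_pos_iff.2 fun h0 => h ⟨0, by rw [h0, zero_smul]⟩
  have h1 := homNorm_mul_le hφ (k := β.length) (by simpa using hβ)
  rw [heq, sub_self] at h1
  have h2 : homNorm f c β.length = 0 :=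
    le_antisymm (nonpos_of_mul_nonpos_left h1 hM) (homNorm_nonneg _ _ _)
  have h3 := homNorm_sq f c β.length
  rw [h2, zero_pow two_ne_zero, eq_comm, Finset.sum_eq_zero_iff_of_nonneg
    fun β _ => div_nonneg (sq_nonneg _) (f.b_pos β).le] at h3
  simpa [(f.b_pos β).ne'] using h3 β (by simp)

/-! ### The Bohr majorant and the operator inequality. -/

/-- The majorant of the norms of the homogeneous parts of `∑_β |c_β| T_β` on `D_{f,1/3}`. -/
def bohrMajorant (M r : ℝ) (k : ℕ) : ℝ :=
  if k = 0 then r else (M ^ 2 - r ^ 2) / M * (1 / 3) ^ k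

theorem hasSum_bohrMajorant (M r : ℝ) :
    HasSum (bohrMajorant M r) (r + (M ^ 2 - r ^ 2) / M / 2) := by
  have h := (hasSum_geometric_of_lt_one (r := (1 / 3 : ℝ)) (by norm_num) (by norm_num)).mul_left
    ((M ^ 2 - r ^ 2) / M * (1 / 3))
  refine (hasSum_nat_add_iff' 1).1 ?_
  have h1 : (fun k => bohrMajorant M r (k + 1)) =
      fun k => (M ^ 2 - r ^ 2) / M * (1 / 3) * (1 / 3) ^ k := by
    funext k
    rw [bohrMajorant, if_neg k.succ_ne_zero, pow_succ]
    ring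
  have h2 : r + (M ^ 2 - r ^ 2) / M / 2 - ∑ i ∈ Finset.range 1, bohrMajorant M r i =
      (M ^ 2 - r ^ 2) / M * (1 / 3) * (1 - 1 / 3)⁻¹ := by
    rw [Finset.sum_range_one, bohrMajorant, if_pos rfl]
    ring
  rw [h1, h2]
  exact h

theorem add_half_eq {M r : ℝ} (hM : 0 < M) :
    r + (M ^ 2 - r ^ 2) / M / 2 = M - (M - r) ^ 2 / (2 * M) := by
  field_simp
  ring

section Hilbert

variable {H : Type*} [NormedAddCommGroup H] [InnerProductSpace ℂ H] [CompleteSpace H]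
  {T : Fin n → H →L[ℂ] H}

/-- Arbitrary subsets of a degree are allowed because unconditional convergence is wanted. -/
theorem norm_fiber_sum_le (hφ : f.IsHardySeries c φ) (hT : T ∈ f.scaledDomain (1 / 3) H) (k : ℕ)
    (s : Finset (Word n)) (hs : ∀ β ∈ s, β.length = k) :
    ‖∑ β ∈ s, (‖c β‖ : ℂ) • wordProd T β‖ ≤ bohrMajorant ‖φ‖ ‖c []‖ k := by
  have hsub : s ⊆ words n k := fun β hβ => mem_words.2 (hs β hβ)
  have h := f.norm_sum_smul_wordProd_le (by norm_num) hT (fun β => (‖c β‖ : ℂ)) hsub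
    (homNorm_nonneg f c k) (by simp [homNorm_sq])
  refine h.trans ?_
  rcases eq_or_ne k 0 with rfl | hk
  · simp [bohrMajorant, homNorm, words_zero, f.b_nil]
  · rw [bohrMajorant, if_neg hk]
    gcongr
    -- If `‖φ‖ = 0`, division by zero makes the majorant `0`, so the coefficients must be shown to
    -- vanish.
    rcases (norm_nonneg φ).eq_or_lt with hM | hM
    · have hφ0 : φ = 0 := norm_eq_zero.1 hM.symm
      have : homNorm f c k = 0 := by
        have hc : ∀ β, c β = 0 := fun β => by
          have h0 := apply_basisVec_nil hφ β
          have hb : √(f.b β) ≠ 0 := (Real.sqrt_pos.2 (f.b_pos β)).ne'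
          rw [hφ0] at h0
          rw [zero_apply] at h0
          exact (mul_eq_zero.1 h0.symm).resolve_right (by simpa using hb)
        simp [homNorm, hc]
      simp [this, ← hM]
    · rw [le_div_iff₀ hM]
      exact homNorm_mul_le hφ hk

/-- The Bohr inequality on the operators of `D_{f,1/3}(H)`. -/
theorem bohr_operator (hφ : f.IsHardySeries c φ) (hT : T ∈ f.scaledDomain (1 / 3) H) :
    (Summable fun k : ℕ => ‖∑ w : Fin k → Fin n,
      (‖c (List.ofFn w)‖ : ℂ) • wordProd T (List.ofFn w)‖) ∧
    (Summable fun β => (‖c β‖ : ℂ) • wordProd T β) ∧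
    ‖∑' β, (‖c β‖ : ℂ) • wordProd T β‖ ≤ ‖φ‖ ∧
    ((¬ ∃ z : ℂ, φ = z • (1 : Fock n →L[ℂ] Fock n)) →
      ‖∑' β, (‖c β‖ : ℂ) • wordProd T β‖ < ‖φ‖) := by
  have hg := hasSum_bohrMajorant ‖φ‖ ‖c []‖
  have h := summable_and_norm_tsum_le_of_fiber_bound (fun β : Word n => β.length) (words n)
    (fun β => by simp) (fun β => (‖c β‖ : ℂ) • wordProd T β) hg.summable
    (norm_fiber_sum_le hφ hT)
  rw [hg.tsum_eq] at h
  refine ⟨?_, h.1, h.2.trans ?_, fun hns => h.2.trans_lt ?_⟩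
  · refine Summable.of_nonneg_of_le (fun _ => norm_nonneg _) (fun k => ?_) hg.summable
    rw [← sum_words fun β => (‖c β‖ : ℂ) • wordProd T β]
    exact norm_fiber_sum_le hφ hT k _ fun β hβ => mem_words.1 hβ
  · rcases (norm_nonneg φ).eq_or_lt with hM | hM
    · have := norm_coeff_nil_le hφ
      rw [← hM] at this ⊢
      simpa using this
    · rw [add_half_eq hM]
      exact sub_le_self _ (by positivity)
  · have hlt := norm_coeff_nil_lt hφ hns
    have hM := (norm_nonneg _).trans_lt hlt
    rw [add_half_eq hM]
    exact sub_lt_self _ (div_pos (pow_pos (sub_pos.2 hlt) 2) (by positivity))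

end Hilbert

/-! ### Reduction of scalar points to operators on `ℂ`. -/

theorem norm_wordProd {A : Type*} [NormedDivisionRing A] (μ : Fin n → A) (β : Word n) :
    ‖wordProd μ β‖ = wordProd (fun i => ‖μ i‖) β :=
  map_wordProd (normHom : A →*₀ ℝ) μ β

theorem wordProd_smul_one {A : Type*} [Ring A] [Algebra ℂ A] (μ : Fin n → ℂ) (β : Word n) :
    wordProd (fun i => μ i • (1 : A)) β = wordProd μ β • (1 : A) := by
  simpa [Algebra.algebraMap_eq_smul_one] using (map_wordProd (algebraMap ℂ A) μ β).symm

theorem smul_one_mem_domain {μ : Fin n → ℂ} (hμ : μ ∈ f.scalarDomain) :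
    (fun i => μ i • (1 : ℂ →L[ℂ] ℂ)) ∈ f.domain ℂ := by
  obtain ⟨hs, hle⟩ := hμ
  refine ⟨((∑' α, f.a α * ‖wordProd μ α‖ ^ 2 : ℝ) : ℂ) • 1, ?_, fun x y => ?_⟩
  · rw [norm_smul, norm_one, mul_one, Complex.norm_real, Real.norm_eq_abs, abs_of_nonneg]
    · exact hle
    · exact tsum_nonneg fun α => mul_nonneg (f.nonneg α) (sq_nonneg _)
  · have h := (Complex.hasSum_ofReal.2 hs.hasSum).mul_right ⟪x, y⟫_ℂ
    have hterm : (fun α => (f.a α : ℂ) * ⟪x, (wordProd (fun i => μ i • (1 : ℂ →L[ℂ] ℂ)) α *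
        ContinuousLinearMap.adjoint (wordProd (fun i => μ i • (1 : ℂ →L[ℂ] ℂ)) α)) y⟫_ℂ) =
        fun α => ((f.a α * ‖wordProd μ α‖ ^ 2 : ℝ) : ℂ) * ⟪x, y⟫_ℂ := by
      funext α
      have hadj : ContinuousLinearMap.adjoint (wordProd μ α • (1 : ℂ →L[ℂ] ℂ)) =
          (starRingEnd ℂ) (wordProd μ α) • (1 : ℂ →L[ℂ] ℂ) := by
        change star (_ • (1 : ℂ →L[ℂ] ℂ)) = _
        rw [star_smul, star_one]
        rfl
      rw [wordProd_smul_one, hadj, smul_mul_smul_comm, Complex.mul_conj', one_mul,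
        smul_apply, one_apply_eq_self, inner_smul_right]
      push_cast
      ring
    rw [hterm, smul_apply, one_apply_eq_self, inner_smul_right]
    exact h

theorem norm_mem_scalarDomain {μ : Fin n → ℂ} (hμ : μ ∈ f.scalarDomain) :
    (fun i => (‖μ i‖ : ℂ)) ∈ f.scalarDomain := by
  have h : ∀ α, ‖wordProd (fun i => (‖μ i‖ : ℂ)) α‖ = ‖wordProd μ α‖ := fun α => by
    simp [norm_wordProd]
  simpa only [PosRegular.scalarDomain, Set.mem_ofPred_eq, h] using hμ

/-- The Bohr inequality on the points of `D_{f,1/3}(ℂ)`. -/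
theorem bohr_scalar (hφ : f.IsHardySeries c φ) {μ : Fin n → ℂ}
    (hμ : μ ∈ f.scaledScalarDomain (1 / 3)) :
    (Summable fun β => ‖c β‖ * ‖wordProd μ β‖) ∧
    ∑' β, ‖c β‖ * ‖wordProd μ β‖ ≤ ‖φ‖ ∧
    ((¬ ∃ z : ℂ, φ = z • (1 : Fock n →L[ℂ] Fock n)) →
      ∑' β, ‖c β‖ * ‖wordProd μ β‖ < ‖φ‖) := by
  -- Taking `|μ_i|` instead of `μ_i` removes the phases, so the norm of the operator sum is the sum
  -- of the moduli.
  have hT : (fun i => (‖μ i‖ : ℂ) • (1 : ℂ →L[ℂ] ℂ)) ∈ f.scaledDomain (1 / 3) ℂ := by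
    have hμ' : (fun i => ((1 / (1 / 3) : ℝ) : ℂ) * μ i) ∈ f.scalarDomain := hμ
    have h := smul_one_mem_domain (norm_mem_scalarDomain hμ')
    simpa [PosRegular.scaledDomain, smul_smul] using h
  obtain ⟨-, hs, hle, hlt⟩ := bohr_operator hφ hT
  have hterm : (fun β => (‖c β‖ : ℂ) • wordProd (fun i => (‖μ i‖ : ℂ) • (1 : ℂ →L[ℂ] ℂ)) β) =
      fun β => ((‖c β‖ * ‖wordProd μ β‖ : ℝ) : ℂ) • (1 : ℂ →L[ℂ] ℂ) := by
    funext β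
    have h := map_wordProd Complex.ofRealHom (fun i => ‖μ i‖) β
    simp only [Complex.ofRealHom_eq_coe] at h
    rw [wordProd_smul_one, smul_smul, norm_wordProd, Complex.ofReal_mul, h]
  rw [hterm] at hs hle hlt
  have hs' : Summable fun β => ‖c β‖ * ‖wordProd μ β‖ := by
    have h := hs.mapL (ContinuousLinearMap.apply ℂ ℂ (1 : ℂ))
    simpa using Complex.summable_ofReal.1 (by simpa using h)
  have hsum : ‖∑' β, ((‖c β‖ * ‖wordProd μ β‖ : ℝ) : ℂ) • (1 : ℂ →L[ℂ] ℂ)‖ =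
      ∑' β, ‖c β‖ * ‖wordProd μ β‖ := by
    rw [((Complex.hasSum_ofReal.2 hs'.hasSum).smul_const (1 : ℂ →L[ℂ] ℂ)).tsum_eq, norm_smul,
      norm_one, mul_one, Complex.norm_real, Real.norm_eq_abs, abs_of_nonneg]
    exact tsum_nonneg fun β => by positivity
  rw [hsum] at hle hlt
  exact ⟨hs', hle, hlt⟩

end HardySeries

end FreeDomain

end

theorem mainTheorem7 {n : ℕ} (f : FreeDomain.PosRegular n)
    (c : FreeDomain.Word n → ℂ) (φ : FreeDomain.Fock n →L[ℂ] FreeDomain.Fock n)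
    (hφ : f.IsHardySeries c φ) :
    (∀ (H : Type*) [NormedAddCommGroup H] [InnerProductSpace ℂ H] [CompleteSpace H]
        (T : Fin n → H →L[ℂ] H), T ∈ f.scaledDomain (1 / 3) H →
      (Summable fun k : ℕ => ‖∑ w : Fin k → Fin n,
        (‖c (List.ofFn w)‖ : ℂ) • FreeDomain.wordProd T (List.ofFn w)‖) ∧
      (Summable fun β => (‖c β‖ : ℂ) • FreeDomain.wordProd T β) ∧
      ‖∑' β, (‖c β‖ : ℂ) • FreeDomain.wordProd T β‖ ≤ ‖φ‖ ∧
      ((¬ ∃ z : ℂ, φ = z • (1 : FreeDomain.Fock n →L[ℂ] FreeDomain.Fock n)) →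
        ‖∑' β, (‖c β‖ : ℂ) • FreeDomain.wordProd T β‖ < ‖φ‖)) ∧
    (∀ μ ∈ f.scaledScalarDomain (1 / 3),
      (Summable fun β => ‖c β‖ * ‖FreeDomain.wordProd μ β‖) ∧
      ∑' β, ‖c β‖ * ‖FreeDomain.wordProd μ β‖ ≤ ‖φ‖ ∧
      ((¬ ∃ z : ℂ, φ = z • (1 : FreeDomain.Fock n →L[ℂ] FreeDomain.Fock n)) →
        ∑' β, ‖c β‖ * ‖FreeDomain.wordProd μ β‖ < ‖φ‖)) :=
  ⟨fun _ _ _ _ _ hT => FreeDomain.bohr_operator hφ hT,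
    fun _ hμ => FreeDomain.bohr_scalar hφ hμ⟩
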